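/- Let $(\mathcal N,\|\cdot\|)$ be a separable (not necessarily complete) real normed vector space endowed with its Borel $\sigma$-algebra, let $\mathcal N^*$ be its topological dual, and let $(X_n)_{n\ge 1}$ be a sequence of independent and identically distributed $\mathcal N$-valued random variables, with empirical means $\overline X_n=(X_1+\dots+X_n)/n$. With $\log 0=-\infty$ and $\log(+\infty)=+\infty$, define the entropy $s:\mathcal N\to[-\infty,0]$ and the pressure $p:\mathcal N^*\to[-\infty,+\infty]$ by \[ s(x)=\inf_{V}\ \liminf_{n\to\infty}\frac1n\log\mathbb P(\overline X_n\in V),\qquad p(\lambda)=\limsup_{n\to\infty}\frac1n\log\mathbb E\bigl(e^{n\lambda(\overline X_n)}\bigr), \] where $V$ ranges over the measurable neighborhoods of $x$, and let $p^*(x)=\sup_{\lambda\in\mathcal N^*}\bigl(\lambda(x)-p(\lambda)\bigr)$. Then $(\overline X_n,n)_{n\ge1}$ satisfies a weak large deviation principle with entropy $s=-p^*$, where $p(\lambda)=\log\mathbb E\bigl(e^{\lambda(X_1)}\bigr)$. That is: 1. for every Borel set $G\subset\mathcal N$, $\displaystyle\liminf_{n\to\infty}\frac1n\log\mathbb P(\overline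 X_n\in G)\ \ge\ \sup_{x\in\mathring G}s(x)$, and for every relatively compact Borel set $K\subset\mathcal N$ (that is, with compact closure $\overline K$), $\displaystyle\limsup_{n\to\infty}\frac1n\log\mathbb P(\overline X_n\in K)\ \le\ \sup_{x\in\overline K}s(x)$ (with $\sup\emptyset=-\infty$); 2. $s(x)=-p^*(x)$ for every $x\in\mathcal N$; 3. $p(\lambda)=\log\mathbb E\bigl(e^{\lambda(X_1)}\bigr)$ for every $\lambda\in\mathcal N^*$. -/

import Mathlib

open MeasureTheory ProbabilityTheory Filter Topology

namespace LargeDeviations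

noncomputable section

/-- The normalized logarithmic probability `(1 / v n) * log P(Z n ∈ A)`, with `log 0 = -∞`. -/
def logProb {Ω E : Type*} [MeasurableSpace Ω] (P : Measure Ω) (Z : ℕ → Ω → E) (v : ℕ → ℝ)
    (A : Set E) (n : ℕ) : EReal :=
  (((v n)⁻¹ : ℝ) : EReal) * ENNReal.log (P (Z n ⁻¹' A))

/-- The entropy of the sequence `(Z n, v n)`: the infimum over the measurable neighborhoods `V` of
`x` of `liminf (1 / v n) * log P(Z n ∈ V)`. (When `x` has a local basis of measurable
neighborhoods, as in any space with its Borel sets, any such basis gives the same infimum.) -/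
def entropy {Ω E : Type*} [MeasurableSpace Ω] [TopologicalSpace E] [MeasurableSpace E]
    (P : Measure Ω) (Z : ℕ → Ω → E) (v : ℕ → ℝ) (x : E) : EReal :=
  ⨅ V ∈ {V : Set E | V ∈ 𝓝 x ∧ MeasurableSet V}, liminf (logProb P Z v V) atTop

/-- The pressure of the sequence `(Z n, v n)`: for a continuous linear functional `φ`, the
`limsup` of `(1 / v n) * log E[exp (v n * φ (Z n))]`; the expectation may be infinite. -/
def pressure {Ω E : Type*} [MeasurableSpace Ω] [AddCommGroup E] [Module ℝ E] [TopologicalSpace E]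
    (P : Measure Ω) (Z : ℕ → Ω → E) (v : ℕ → ℝ) (φ : E →L[ℝ] ℝ) : EReal :=
  limsup (fun n => (((v n)⁻¹ : ℝ) : EReal) *
    ENNReal.log (∫⁻ ω, ENNReal.ofReal (Real.exp (v n * φ (Z n ω))) ∂P)) atTop

/-- The Fenchel-Legendre transform `h*(x) = sup_φ (φ x - h φ)` of a function on the topological
dual. -/
def fenchelLegendre {E : Type*} [AddCommGroup E] [Module ℝ E] [TopologicalSpace E]
    (h : (E →L[ℝ] ℝ) → EReal) (x : E) : EReal :=
  ⨆ φ : E →L[ℝ] ℝ, ((φ x : ℝ) : EReal) - h φ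

/-- The weak large deviation principle for `(Z n, v n)` with a function `s`: the lower
bound on the interiors of all measurable sets, and the upper bound on the closures of all
relatively compact measurable sets. -/
structure WeakLDP {Ω E : Type*} [MeasurableSpace Ω] [TopologicalSpace E] [MeasurableSpace E]
    (P : Measure Ω) (Z : ℕ → Ω → E) (v : ℕ → ℝ) (s : E → EReal) : Prop where
  lower_bound : ∀ G : Set E, MeasurableSet G →
    (⨆ x ∈ interior G, s x) ≤ liminf (logProb P Z v G) atTop
  upper_bound : ∀ K : Set E, MeasurableSet K → IsCompact (closure K) →
    limsup (logProb P Z v K) atTop ≤ ⨆ x ∈ closure K, s x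

/-- The empirical mean of the first `n` variables of the sequence `X 0, X 1, …`
(so that `X k` is the variable of rank `k + 1`). -/
def empiricalMean {Ω E : Type*} [AddCommGroup E] [Module ℝ E] (X : ℕ → Ω → E) (n : ℕ) (ω : Ω) :
    E :=
  ((n : ℝ)⁻¹) • ∑ k ∈ Finset.range n, X k ω

end

end LargeDeviations

/-! Everything is read off the laws `sumLaw μ n` of the sums, `μ` being the common law, and
`hypograph μ`, the real hypograph of the entropy. Concatenating blocks of summands makes this set
convex (`convex_hypograph`). It also gives superadditivity: a point outside the hypograph has a ball
with an exponential bound valid for every `n`, without constant (`exists_sumLaw_ball_le`). Finite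
covers then yield the upper bound on compact sets.

The inequality `s ≤ -p*` is exponential Chebyshev. For the converse, a point outside the closed
convex hypograph is separated from it by Hahn-Banach, so what is needed is `log E[exp φ] ≤ u` as
soon as `φ x + t ≤ u` on the hypograph. On a compact convex `K`, the `n`-th power of the integral of
`exp φ` is at most the integral of `exp φ` over the event that the mean lies in `K`; a finite cover
bounds the latter by a constant times `exp (n (u + 2δ))`, and `n`-th roots remove the constant
(`setLIntegral_exp_le_of_isCompact`). If the space is complete, tightness of `μ` exhausts it by
compact sets, whose closed convex hulls remain compact. The general case embeds the space in its
completion. -/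

namespace LargeDeviations

/-! ### Convolution powers. -/

/-- The law of the sum of `n` independent variables of law `μ`: the `n`-th convolution power. -/
noncomputable def sumLaw {E : Type*} [AddCommMonoid E] [MeasurableSpace E] (μ : Measure E) :
    ℕ → Measure E
  | 0 => Measure.dirac 0
  | n + 1 => Measure.conv (sumLaw μ n) μ

section Convolution

variable {E : Type*} [AddCommMonoid E] [MeasurableSpace E] [MeasurableAdd₂ E]

instance isProbabilityMeasure_sumLaw (μ : Measure E) [IsProbabilityMeasure μ] (n : ℕ) :
    IsProbabilityMeasure (sumLaw μ n) := by
  induction n with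
  | zero => unfold sumLaw; infer_instance
  | succ n ih => unfold sumLaw; infer_instance

theorem sumLaw_add (μ : Measure E) [IsProbabilityMeasure μ] (m n : ℕ) :
    sumLaw μ (m + n) = Measure.conv (sumLaw μ m) (sumLaw μ n) := by
  induction n with
  | zero => simp [sumLaw]
  | succ n ih =>
    rw [← add_assoc, sumLaw, ih, sumLaw, Measure.conv_assoc]

theorem measure_mul_le_conv (μ ν : Measure E) [SFinite ν] {A B C : Set E}
    (h : ∀ a ∈ A, ∀ b ∈ B, a + b ∈ C) : μ A * ν B ≤ Measure.conv μ ν C := by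
  rw [Measure.conv, ← Measure.prod_prod]
  refine le_trans (measure_mono ?_) (Measure.le_map_apply (by fun_prop) C)
  rintro ⟨a, b⟩ ⟨ha, hb⟩
  exact h a ha b hb

theorem sumLaw_mul_le (μ : Measure E) [IsProbabilityMeasure μ] (m n : ℕ) {A B C : Set E}
    (h : ∀ a ∈ A, ∀ b ∈ B, a + b ∈ C) :
    sumLaw μ m A * sumLaw μ n B ≤ sumLaw μ (m + n) C := by
  rw [sumLaw_add]
  exact measure_mul_le_conv _ _ h

theorem map_sum_range_eq_sumLaw {Ω : Type*} [MeasurableSpace Ω] (P : Measure Ω)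
    [IsProbabilityMeasure P] (X : ℕ → Ω → E) (hmeas : ∀ k, Measurable (X k))
    (hindep : iIndepFun X P) (hident : ∀ k, IdentDistrib (X k) (X 0) P P) (n : ℕ) :
    P.map (fun ω => ∑ k ∈ Finset.range n, X k ω) = sumLaw (P.map (X 0)) n := by
  induction n with
  | zero => simp [sumLaw]
  | succ n ih =>
    have h : IndepFun (fun ω => ∑ k ∈ Finset.range n, X k ω) (X n) P := by
      have := hindep.indepFun_finsetSum_of_notMem hmeas (Finset.notMem_range_self (n := n))
      rwa [Finset.sum_fn] at this
    have h2 := h.map_add_eq_map_conv_map (Finset.measurable_sum _ fun k _ => hmeas k) (hmeas n)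
    rw [sumLaw, ← ih, ← (hident n).map_eq, ← h2]
    congr 1
    ext ω
    simp [Finset.sum_range_succ]

end Convolution

/-! ### Exponential moments of convolution powers. -/

section Exponential

variable {E : Type*} [NormedAddCommGroup E] [NormedSpace ℝ E] [SecondCountableTopology E]
  [MeasurableSpace E] [BorelSpace E]

theorem lintegral_exp_sumLaw (μ : Measure E) [IsProbabilityMeasure μ] (φ : E →L[ℝ] ℝ) (n : ℕ) :
    ∫⁻ x, ENNReal.ofReal (Real.exp (φ x)) ∂(sumLaw μ n) =
      (∫⁻ x, ENNReal.ofReal (Real.exp (φ x)) ∂μ) ^ n := by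
  have hm : Measurable fun x : E => ENNReal.ofReal (Real.exp (φ x)) := by fun_prop
  induction n with
  | zero => simp [sumLaw, lintegral_dirac' _ hm]
  | succ n ih =>
    rw [sumLaw, Measure.lintegral_conv hm, pow_succ, ← ih, ← lintegral_mul_const _ hm]
    refine lintegral_congr fun x => ?_
    rw [← lintegral_const_mul _ hm]
    refine lintegral_congr fun y => ?_
    rw [map_add, Real.exp_add, ENNReal.ofReal_mul (Real.exp_pos _).le]

/-- If the `n` summands lie in a convex set `K`, then so does their mean. -/
theorem setLIntegral_exp_pow_le (μ : Measure E) [IsProbabilityMeasure μ] (φ : E →L[ℝ] ℝ)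
    {K : Set E} (hK : Convex ℝ K) (hKm : MeasurableSet K) (n : ℕ) :
    (∫⁻ x in K, ENNReal.ofReal (Real.exp (φ x)) ∂μ) ^ (n + 1) ≤
      ∫⁻ x in (fun y => ((n + 1 : ℕ) : ℝ)⁻¹ • y) ⁻¹' K,
        ENNReal.ofReal (Real.exp (φ x)) ∂(sumLaw μ (n + 1)) := by
  have hm : Measurable fun x : E => ENNReal.ofReal (Real.exp (φ x)) := by fun_prop
  have hKn (n : ℕ) : MeasurableSet ((fun y : E => ((n + 1 : ℕ) : ℝ)⁻¹ • y) ⁻¹' K) :=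
    hKm.preimage (by fun_prop)
  induction n with
  | zero => simp [sumLaw]
  | succ n ih =>
    rw [sumLaw, ← lintegral_indicator (hKn _), Measure.lintegral_conv (hm.indicator (hKn _)),
      pow_succ]
    refine (mul_le_mul_left ih _).trans ?_
    rw [← lintegral_indicator (hKn _), ← lintegral_indicator hKm,
      ← lintegral_mul_const _ (hm.indicator (hKn _))]
    refine lintegral_mono fun x => ?_
    rw [← lintegral_const_mul _ (hm.indicator hKm)]
    refine lintegral_mono fun y => ?_
    by_cases hx : x ∈ (fun y : E => ((n + 1 : ℕ) : ℝ)⁻¹ • y) ⁻¹' K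
    · by_cases hy : y ∈ K
      · have hxy : x + y ∈ (fun y : E => ((n + 1 + 1 : ℕ) : ℝ)⁻¹ • y) ⁻¹' K := by
          have hn : (0 : ℝ) < ((n + 1 : ℕ) : ℝ) := by positivity
          -- The mean of `n + 2` terms is the convex combination of the mean of the first `n + 1`
          -- and the last one.
          have := hK hx hy (a := (n + 1 : ℕ) / ((n + 1 + 1 : ℕ) : ℝ))
            (b := ((n + 1 + 1 : ℕ) : ℝ)⁻¹) (by positivity) (by positivity)
            (by push_cast; field_simp)
          rw [Set.mem_preimage, smul_add]
          rwa [smul_smul, div_mul_eq_mul_div, mul_inv_cancel₀ hn.ne', one_div] at this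
        rw [Set.indicator_of_mem hx, Set.indicator_of_mem hy, Set.indicator_of_mem hxy, map_add,
          Real.exp_add, ENNReal.ofReal_mul (Real.exp_pos _).le]
      · simp [Set.indicator_of_notMem hy]
    · rw [Set.indicator_of_notMem hx, zero_mul]
      exact zero_le

end Exponential

end LargeDeviations

/-! ### The hypograph of the entropy: closedness, convexity, superadditivity. -/

namespace LargeDeviations

/-- The pairs `(x, t)` such that `t` is at most the entropy at `x` of the means of independent
variables of law `μ`. -/
def hypograph {E : Type*} [NormedAddCommGroup E] [NormedSpace ℝ E] [MeasurableSpace E]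
    (μ : Measure E) : Set (E × ℝ) :=
  {q | ∀ ε > 0, ∀ᶠ n : ℕ in atTop, ENNReal.ofReal (Real.exp (n * (q.2 - ε))) ≤
    sumLaw μ n (Metric.ball ((n : ℝ) • q.1) (n * ε))}

variable {E : Type*} [NormedAddCommGroup E] [NormedSpace ℝ E] [MeasurableSpace E]

theorem mem_hypograph_of_le {μ : Measure E} {x : E} {s t : ℝ} (h : (x, t) ∈ hypograph μ)
    (hst : s ≤ t) : (x, s) ∈ hypograph μ := by
  intro ε hε
  filter_upwards [h ε hε] with n hn
  refine le_trans ?_ hn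
  gcongr

theorem isClosed_hypograph (μ : Measure E) : IsClosed (hypograph μ) := by
  refine isClosed_of_closure_subset fun q hq ε hε => ?_
  obtain ⟨r, hr, hqr⟩ := Metric.mem_closure_iff.1 hq (ε / 2) (half_pos hε)
  rw [Prod.dist_eq, max_lt_iff, Real.dist_eq, abs_lt] at hqr
  filter_upwards [hr (ε / 2) (half_pos hε)] with n hn
  refine le_trans ?_ (hn.trans (measure_mono (Metric.ball_subset_ball' ?_)))
  · gcongr ENNReal.ofReal (Real.exp (n * ?_))
    linarith [hqr.2.1]
  · rw [dist_smul₀, Real.norm_natCast, ← mul_add, dist_comm]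
    gcongr
    linarith [hqr.1]

theorem snd_nonpos_of_mem_hypograph [SecondCountableTopology E] [BorelSpace E] {μ : Measure E}
    [IsProbabilityMeasure μ] {q : E × ℝ} (h : q ∈ hypograph μ) : q.2 ≤ 0 := by
  refine le_of_forall_pos_le_add fun ε hε => ?_
  obtain ⟨n, hn, hn0⟩ := ((h ε hε).and (eventually_gt_atTop 0)).exists
  have h1 := hn.trans prob_le_one
  rw [ENNReal.ofReal_le_one, Real.exp_le_one_iff] at h1
  have hn0' : (0 : ℝ) < n := by exact_mod_cast hn0
  nlinarith

theorem eventually_le_natCast_mul {c : ℝ} (hc : 0 < c) (b : ℝ) : ∀ᶠ n : ℕ in atTop, b ≤ n * c :=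
  (tendsto_natCast_atTop_atTop.atTop_mul_const hc).eventually_ge_atTop b

/-- Of `n` summands, the first `⌊a n⌋` are steered towards `x` and the others towards `y`. Rounding
costs a bounded amount, absorbed by the slack `n * (ε / 2)`. -/
theorem convex_hypograph [SecondCountableTopology E] [BorelSpace E] (μ : Measure E)
    [IsProbabilityMeasure μ] : Convex ℝ (hypograph μ) := by
  rw [convex_iff_forall_pos]
  rintro ⟨x, s⟩ hx ⟨y, t⟩ hy a b ha hb hab ε hε
  have hfloor : Tendsto (fun n : ℕ => ⌊a * n⌋₊) atTop atTop :=
    tendsto_nat_floor_atTop.comp (tendsto_natCast_atTop_atTop.const_mul_atTop ha)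
  have hle (n : ℕ) : ⌊a * n⌋₊ ≤ n := by
    refine Nat.floor_le_of_le ?_
    have : (0 : ℝ) ≤ n := by positivity
    nlinarith
  have hsub : Tendsto (fun n : ℕ => n - ⌊a * n⌋₊) atTop atTop := by
    have : Tendsto (fun n : ℕ => ((n - ⌊a * n⌋₊ : ℕ) : ℝ)) atTop atTop := by
      refine tendsto_atTop_mono (fun n => ?_)
        ((tendsto_natCast_atTop_atTop (R := ℝ)).const_mul_atTop hb)
      rw [Nat.cast_sub (hle n)]
      have : (⌊a * n⌋₊ : ℝ) ≤ a * n := Nat.floor_le (by positivity)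
      have : b * n = n - a * n := by linear_combination (n : ℝ) * hab
      linarith
    exact tendsto_natCast_atTop_iff.1 this
  filter_upwards [hfloor.eventually (hx (ε / 2) (half_pos hε)),
    hsub.eventually (hy (ε / 2) (half_pos hε)),
    eventually_le_natCast_mul (half_pos hε) (|s| + |t|),
    eventually_le_natCast_mul (half_pos hε) (‖x‖ + ‖y‖)] with n h1 h2 h3 h4
  obtain ⟨m, hm⟩ := Nat.exists_eq_add_of_le (hle n)
  set k := ⌊a * n⌋₊ with hk
  have hkm : n - k = m := by omega
  rw [hkm] at h2
  have hkm' : (n : ℝ) = k + m := by exact_mod_cast hm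
  have hka : |(k : ℝ) - n * a| ≤ 1 := by
    rw [abs_le]
    constructor
    · linarith [Nat.lt_floor_add_one (a * (n : ℝ))]
    · linarith [Nat.floor_le (show (0 : ℝ) ≤ a * n by positivity)]
  have hmb : (m : ℝ) - n * b = -(k - n * a) := by
    linear_combination -hkm' - (n : ℝ) * hab
  have hmb' : |(m : ℝ) - n * b| ≤ 1 := by rwa [hmb, abs_neg]
  refine le_trans ?_ ((mul_le_mul' h1 h2).trans (hm ▸ sumLaw_mul_le μ k m ?_))
  · rw [← ENNReal.ofReal_mul (Real.exp_pos _).le, ← Real.exp_add]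
    refine ENNReal.ofReal_le_ofReal (Real.exp_le_exp.2 ?_)
    have e1 : |((k : ℝ) - n * a) * s| ≤ |s| := by
      rw [abs_mul]; exact mul_le_of_le_one_left (abs_nonneg _) hka
    have e2 : |((m : ℝ) - n * b) * t| ≤ |t| := by
      rw [abs_mul]; exact mul_le_of_le_one_left (abs_nonneg _) hmb'
    have e3 := (abs_le.1 e1).1
    have e4 := (abs_le.1 e2).1
    have e5 : (n : ℝ) * ε = (k + m) * ε := by rw [hkm']
    simp only [Prod.smul_mk, Prod.mk_add_mk, smul_eq_mul]
    linarith
  · intro u hu v hv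
    rw [mem_ball_iff_norm] at hu hv ⊢
    have e : u + v - (n : ℝ) • (a • x + b • y) = (u - (k : ℝ) • x) + (v - (m : ℝ) • y) +
        (((k : ℝ) - n * a) • x + ((m : ℝ) - n * b) • y) := by module
    have e1 : ‖((k : ℝ) - n * a) • x‖ ≤ ‖x‖ := by
      rw [norm_smul]; exact mul_le_of_le_one_left (norm_nonneg _) hka
    have e2 : ‖((m : ℝ) - n * b) • y‖ ≤ ‖y‖ := by
      rw [norm_smul]; exact mul_le_of_le_one_left (norm_nonneg _) hmb'
    have e5 : (n : ℝ) * ε = (k + m) * ε := by rw [hkm']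
    simp only [Prod.smul_mk, Prod.mk_add_mk]
    rw [← hm, e]
    refine lt_of_le_of_lt ((norm_add_le _ _).trans (add_le_add (norm_add_le _ _)
      (norm_add_le _ _))) ?_
    linarith

theorem pow_sumLaw_closedBall_le [SecondCountableTopology E] [BorelSpace E] (μ : Measure E)
    [IsProbabilityMeasure μ] (N : ℕ) (x : E) (r : ℝ) (q : ℕ) :
    sumLaw μ N (Metric.closedBall ((N : ℝ) • x) (N * r)) ^ q ≤
      sumLaw μ (q * N) (Metric.closedBall (((q * N : ℕ) : ℝ) • x) ((q * N : ℕ) * r)) := by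
  induction q with
  | zero => simp [sumLaw]
  | succ q ih =>
    rw [pow_succ, Nat.succ_mul]
    refine (mul_le_mul_left ih _).trans (sumLaw_mul_le μ _ _ ?_)
    intro u hu v hv
    rw [mem_closedBall_iff_norm] at hu hv ⊢
    rw [Nat.cast_add, add_smul, add_sub_add_comm, add_mul]
    exact (norm_add_le _ _).trans (add_le_add hu hv)

omit [NormedSpace ℝ E] in
theorem exists_half_le_sumLaw_ball [SecondCountableTopology E] [BorelSpace E] (μ : Measure E)
    [IsProbabilityMeasure μ] (N : ℕ) :
    ∃ R : ℝ, ∀ i < N, ENNReal.ofReal (1 / 2) ≤ sumLaw μ i (Metric.ball 0 R) := by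
  have h (i : ℕ) : ∀ᶠ R : ℕ in atTop, ENNReal.ofReal (1 / 2) ≤
      sumLaw μ i (Metric.ball 0 (R : ℝ)) := by
    have h1 : Tendsto (fun R : ℕ => sumLaw μ i (Metric.ball 0 (R : ℝ))) atTop
        (𝓝 (sumLaw μ i (⋃ R : ℕ, Metric.ball 0 (R : ℝ)))) :=
      tendsto_measure_iUnion_atTop fun a b hab => Metric.ball_subset_ball (by exact_mod_cast hab)
    rw [Metric.iUnion_ball_nat, measure_univ] at h1
    refine h1.eventually_const_le ?_
    rw [ENNReal.ofReal_lt_one]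
    norm_num
  obtain ⟨R, hR⟩ := ((Set.finite_lt_nat N).eventually_all.2 fun i _ => h i).exists
  exact ⟨R, hR⟩

/-- Superadditivity: a lower bound for one mean gives one for all later means. -/
theorem eventually_exp_le_sumLaw_ball [SecondCountableTopology E] [BorelSpace E] (μ : Measure E)
    [IsProbabilityMeasure μ] {N : ℕ} (hN : N ≠ 0) {x : E} {t ε : ℝ} (hε : 0 < ε)
    (h : ENNReal.ofReal (Real.exp (N * (t - ε / 2))) ≤
      sumLaw μ N (Metric.closedBall ((N : ℝ) • x) (N * (ε / 2)))) :
    ∀ᶠ n : ℕ in atTop, ENNReal.ofReal (Real.exp (n * (t - ε))) ≤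
      sumLaw μ n (Metric.ball ((n : ℝ) • x) (n * ε)) := by
  have hNpos : (0 : ℝ) < N := by positivity
  have ht : t - ε / 2 ≤ 0 := by
    have h1 := h.trans prob_le_one
    rw [ENNReal.ofReal_le_one, Real.exp_le_one_iff] at h1
    nlinarith
  obtain ⟨R, hR⟩ := exists_half_le_sumLaw_ball μ N
  filter_upwards [eventually_le_natCast_mul (half_pos hε) 1,
    eventually_le_natCast_mul (half_pos hε) (R + N * ‖x‖)] with n h1 h2
  -- The `q` full blocks of length `N` each use the hypothesis; the `i < N` remaining terms stay in
  -- a fixed ball with probability at least `1 / 2`, negligible on the exponential scale.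
  obtain ⟨q, i, hi, rfl⟩ : ∃ q i, i < N ∧ n = q * N + i :=
    ⟨n / N, n % N, Nat.mod_lt _ (Nat.pos_of_ne_zero hN), by rw [mul_comm, Nat.div_add_mod]⟩
  have hiN : (i : ℝ) ≤ N := by exact_mod_cast hi.le
  refine le_trans ?_ ((mul_le_mul' ((pow_le_pow_left₀ zero_le h q).trans
    (pow_sumLaw_closedBall_le μ N x _ q)) (hR i hi)).trans (sumLaw_mul_le μ _ _ ?_))
  · rw [← ENNReal.ofReal_pow (Real.exp_pos _).le, ← ENNReal.ofReal_mul (by positivity),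
      ← Real.exp_nat_mul]
    refine ENNReal.ofReal_le_ofReal ?_
    have h3 : Real.exp (-1) ≤ 1 / 2 := by
      rw [Real.exp_neg, one_div]
      gcongr
      linarith [Real.add_one_le_exp (1 : ℝ)]
    refine le_trans ?_ (mul_le_mul_of_nonneg_left h3 (Real.exp_pos _).le)
    rw [← Real.exp_add, Real.exp_le_exp]
    push_cast at h1 ⊢
    have : (i : ℝ) * (t - ε / 2) ≤ 0 := mul_nonpos_of_nonneg_of_nonpos (by positivity) ht
    linarith
  · intro u hu v hv
    rw [mem_closedBall_iff_norm] at hu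
    rw [mem_ball_zero_iff] at hv
    rw [mem_ball_iff_norm]
    have e : u + v - ((q * N + i : ℕ) : ℝ) • x = (u - ((q * N : ℕ) : ℝ) • x) + v +
        -((i : ℝ) • x) := by
      push_cast
      module
    rw [e]
    refine lt_of_le_of_lt (norm_add₃_le) ?_
    rw [norm_neg, norm_smul, Real.norm_natCast]
    have h4 : (i : ℝ) * ‖x‖ ≤ N * ‖x‖ := by gcongr
    have h5 : (0 : ℝ) ≤ i * (ε / 2) := by positivity
    push_cast at h2 hu ⊢
    linarith

/-- Contrapositive of superadditivity: exceeding the bound at a single `n` would force the lower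
bound at all large times. -/
theorem exists_sumLaw_ball_le [SecondCountableTopology E] [BorelSpace E] {μ : Measure E}
    [IsProbabilityMeasure μ] {x : E} {t : ℝ} (h : (x, t) ∉ hypograph μ) :
    ∃ ε > 0, ∀ n : ℕ, sumLaw μ n (Metric.ball ((n : ℝ) • x) (n * ε)) ≤
      ENNReal.ofReal (Real.exp (n * t)) := by
  simp only [hypograph, Set.mem_ofPred_eq, not_forall] at h
  obtain ⟨ε, hε, h⟩ := h
  refine ⟨ε / 2, half_pos hε, fun n => ?_⟩
  rcases eq_or_ne n 0 with rfl | hn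
  · simp
  by_contra! hlt
  refine h (eventually_exp_le_sumLaw_ball μ hn hε (le_trans ?_
    (hlt.le.trans (measure_mono Metric.ball_subset_closedBall))))
  gcongr
  linarith

end LargeDeviations

/-! ### Exponential moments bounded by the hypograph, and Hahn-Banach duality. -/

namespace LargeDeviations

/-- Taking `n`-th roots removes `c`, later the number of balls in a finite cover. -/
theorem le_of_pow_succ_le_const_mul_pow {a b c : ENNReal} (hc : c ≠ ⊤)
    (h : ∀ n : ℕ, a ^ (n + 1) ≤ c * b ^ (n + 1)) : a ≤ b := by
  have := ExpGrowth.expGrowthSup_le_of_eventually_le (u := fun n => a ^ n) (v := fun n => b ^ n) hc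
    (by filter_upwards [eventually_ge_atTop 1] with n hn
        obtain ⟨m, rfl⟩ := Nat.exists_eq_add_of_le' hn
        exact h m)
  rwa [ExpGrowth.expGrowthSup_pow, ExpGrowth.expGrowthSup_pow, ENNReal.log_le_log_iff] at this

theorem setLIntegral_biUnion_finset_le {α ι : Type*} [MeasurableSpace α] (μ : Measure α)
    (f : α → ENNReal) (t : Finset ι) (s : ι → Set α) :
    ∫⁻ x in ⋃ i ∈ t, s i, f x ∂μ ≤ ∑ i ∈ t, ∫⁻ x in s i, f x ∂μ := by
  classical
  induction t using Finset.induction_on with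
  | empty => simp
  | insert i t hi ih =>
    rw [Finset.set_biUnion_insert, Finset.sum_insert hi]
    exact (lintegral_union_le _ _ _).trans (add_le_add le_rfl ih)

variable {E : Type*} [NormedAddCommGroup E] [NormedSpace ℝ E] [SecondCountableTopology E]
  [MeasurableSpace E] [BorelSpace E]

theorem setLIntegral_exp_le_of_isCompact (μ : Measure E) [IsProbabilityMeasure μ]
    (φ : E →L[ℝ] ℝ) {u : ℝ} (h : ∀ q ∈ hypograph μ, φ q.1 + q.2 ≤ u) {K : Set E}
    (hK : IsCompact K) (hKc : Convex ℝ K) :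
    ∫⁻ x in K, ENNReal.ofReal (Real.exp (φ x)) ∂μ ≤ ENNReal.ofReal (Real.exp u) := by
  have key (δ : ℝ) (hδ : 0 < δ) : ∫⁻ x in K, ENNReal.ofReal (Real.exp (φ x)) ∂μ ≤
      ENNReal.ofReal (Real.exp (u + 2 * δ)) := by
    have hball (x : E) : ∃ r > 0, (∀ n : ℕ, sumLaw μ n (Metric.ball ((n : ℝ) • x) (n * r)) ≤
        ENNReal.ofReal (Real.exp (n * (u - φ x + δ)))) ∧
        ∀ y ∈ Metric.ball x r, φ y ≤ φ x + δ := by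
      obtain ⟨ε, hε, hε'⟩ := exists_sumLaw_ball_le (μ := μ) (x := x) (t := u - φ x + δ)
        fun hx => by linarith [h _ hx]
      obtain ⟨r, hr, hr'⟩ := Metric.eventually_nhds_iff_ball.1
        (φ.continuous.continuousAt.eventually_le_const (show φ x < φ x + δ by linarith))
      refine ⟨min ε r, lt_min hε hr, fun n => (measure_mono (Metric.ball_subset_ball ?_)).trans
        (hε' n), fun y hy => hr' y (Metric.ball_subset_ball (min_le_right _ _) hy)⟩
      gcongr
      exact min_le_left _ _
    choose r hr hr1 hr2 using hball
    obtain ⟨t, -, htK⟩ := hK.elim_nhds_subcover (fun x => Metric.ball x (r x))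
      fun x _ => Metric.ball_mem_nhds x (hr x)
    -- The cover of `K` does not depend on `n`; scaled by `n`, it covers the event that the mean
    -- lies in `K`.
    refine le_of_pow_succ_le_const_mul_pow (c := t.card) (ENNReal.natCast_ne_top _) fun n => ?_
    refine (setLIntegral_exp_pow_le μ φ hKc hK.measurableSet n).trans ?_
    have hn : (0 : ℝ) < (n + 1 : ℕ) := by positivity
    generalize n + 1 = n at hn
    have hsub : (fun y : E => (n : ℝ)⁻¹ • y) ⁻¹' K ⊆
        ⋃ x ∈ t, Metric.ball ((n : ℝ) • x) (n * r x) := by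
      intro y hy
      obtain ⟨x, hxt, hx⟩ := Set.mem_iUnion₂.1 (htK hy)
      refine Set.mem_iUnion₂.2 ⟨x, hxt, ?_⟩
      rw [Metric.mem_ball] at hx ⊢
      have : y = (n : ℝ) • (n : ℝ)⁻¹ • y := (smul_inv_smul₀ hn.ne' y).symm
      rw [this, dist_smul₀, Real.norm_natCast]
      gcongr
    refine (lintegral_mono_set hsub).trans ((setLIntegral_biUnion_finset_le _ _ _ _).trans ?_)
    rw [← nsmul_eq_mul]
    refine Finset.sum_le_card_nsmul _ _ _ fun x _ => ?_
    have hexp : ∀ y ∈ Metric.ball ((n : ℝ) • x) (n * r x),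
        ENNReal.ofReal (Real.exp (φ y)) ≤ ENNReal.ofReal (Real.exp (n * (φ x + δ))) := by
      intro y hy
      have hy' : (n : ℝ)⁻¹ • y ∈ Metric.ball x (r x) := by
        rw [Metric.mem_ball] at hy ⊢
        have : y = (n : ℝ) • (n : ℝ)⁻¹ • y := (smul_inv_smul₀ hn.ne' y).symm
        rw [this, dist_smul₀, Real.norm_natCast] at hy
        exact lt_of_mul_lt_mul_left hy hn.le
      have h2 := hr2 x _ hy'
      rw [map_smul, smul_eq_mul, inv_mul_le_iff₀ hn] at h2
      gcongr
    refine (setLIntegral_mono' Metric.isOpen_ball.measurableSet hexp).trans ?_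
    rw [setLIntegral_const]
    refine (mul_le_mul_right (hr1 x n) _).trans ?_
    rw [← ENNReal.ofReal_mul (Real.exp_pos _).le, ← Real.exp_add,
      ← ENNReal.ofReal_pow (Real.exp_pos _).le, ← Real.exp_nat_mul]
    gcongr ENNReal.ofReal (Real.exp ?_)
    linarith
  have hlim : Tendsto (fun δ : ℝ => ENNReal.ofReal (Real.exp (u + 2 * δ))) (𝓝[>] 0)
      (𝓝 (ENNReal.ofReal (Real.exp u))) := by
    have : Continuous fun δ : ℝ => ENNReal.ofReal (Real.exp (u + 2 * δ)) :=
      ENNReal.continuous_ofReal.comp (by fun_prop)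
    simpa using (this.tendsto 0).mono_left nhdsWithin_le_nhds
  exact ge_of_tendsto hlim (eventually_mem_nhdsWithin.mono key)

omit [NormedSpace ℝ E] in
/-- A bound for the integrals over compact sets gives a bound for the integral. -/
theorem lintegral_le_of_forall_isCompact [CompleteSpace E] (μ : Measure E) [IsFiniteMeasure μ]
    (f : E → ENNReal) {c : ENNReal} (h : ∀ K, IsCompact K → ∫⁻ x in K, f x ∂μ ≤ c) :
    ∫⁻ x, f x ∂μ ≤ c := by
  have htight := isTightMeasureSet_iff_exists_isCompact_measure_compl_le.1
    (isTightMeasureSet_singleton (μ := μ))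
  have hK (n : ℕ) : ∃ K, IsCompact K ∧ μ Kᶜ ≤ (n : ENNReal)⁻¹ := by
    obtain ⟨K, hK, hK'⟩ := htight (n : ENNReal)⁻¹ (by simp)
    exact ⟨K, hK, hK' μ rfl⟩
  choose K hK hKμ using hK
  have hnull : μ (⋃ n, K n)ᶜ = 0 := by
    refine le_antisymm (ge_of_tendsto' ENNReal.tendsto_inv_nat_nhds_zero fun n => ?_) zero_le
    exact (measure_mono (Set.compl_subset_compl.2 (Set.subset_iUnion K n))).trans (hKμ n)
  rw [← Measure.restrict_eq_self_of_ae_mem (s := ⋃ n, K n) (μ := μ) hnull,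
    ← Set.iUnion_accumulate, setLIntegral_iUnion_of_directed _ Set.monotone_accumulate.directed_le]
  exact iSup_le fun n => h _ (isCompact_accumulate hK n)

theorem lintegral_exp_le [CompleteSpace E] (μ : Measure E) [IsProbabilityMeasure μ]
    (φ : E →L[ℝ] ℝ) {u : ℝ} (h : ∀ q ∈ hypograph μ, φ q.1 + q.2 ≤ u) :
    ∫⁻ x, ENNReal.ofReal (Real.exp (φ x)) ∂μ ≤ ENNReal.ofReal (Real.exp u) :=
  lintegral_le_of_forall_isCompact μ _ fun _ hK =>
    (lintegral_mono_set ((subset_convexHull ℝ _).trans subset_closure)).trans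
      (setLIntegral_exp_le_of_isCompact μ φ h
        (isCompact_iff_totallyBounded_isComplete.2
          ⟨hK.totallyBounded.convexHull.closure, isClosed_closure.isComplete⟩)
        (convex_convexHull ℝ _).closure)

/-- Were it empty, the previous bound with `φ = 0` and `u = -1` would hold vacuously and give total
mass at most `exp (-1)`. -/
theorem nonempty_hypograph [CompleteSpace E] (μ : Measure E) [IsProbabilityMeasure μ] :
    (hypograph μ).Nonempty := by
  by_contra hempty
  rw [Set.not_nonempty_iff_eq_empty] at hempty
  have h := lintegral_exp_le μ 0 (u := -1) (by simp [hempty])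
  simp only [zero_apply, Real.exp_zero, ENNReal.ofReal_one, lintegral_one,
    measure_univ, ENNReal.one_le_ofReal] at h
  rw [Real.one_le_exp_iff] at h
  norm_num at h

theorem exists_lintegral_exp_le_of_completeSpace [CompleteSpace E] (μ : Measure E)
    [IsProbabilityMeasure μ] {x : E} {c : ℝ} (hx : (x, c) ∉ hypograph μ) :
    ∃ φ : E →L[ℝ] ℝ, ∫⁻ y, ENNReal.ofReal (Real.exp (φ y)) ∂μ ≤
      ENNReal.ofReal (Real.exp (φ x + c)) := by
  obtain ⟨f, u, hf, hfx⟩ := geometric_hahn_banach_closed_point (convex_hypograph μ)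
    (isClosed_hypograph μ) hx
  set φ : E →L[ℝ] ℝ := f.comp (ContinuousLinearMap.inl ℝ E ℝ) with hφ
  set a : ℝ := f (0, 1) with ha
  have hfφ (y : E) (t : ℝ) : f (y, t) = φ y + a * t := by
    have : (y, t) = (y, 0) + t • ((0, 1) : E × ℝ) := by simp
    rw [this, map_add, map_smul, smul_eq_mul, mul_comm]
    rfl
  rw [hfφ] at hfx
  -- The hypograph is stable downwards, so `a < 0` would make `f` unbounded above on it.
  have ha0 : 0 ≤ a := by
    by_contra! hneg
    obtain ⟨q, hq⟩ := nonempty_hypograph μ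
    have h := hf _ (mem_hypograph_of_le (x := q.1) (s := min q.2 ((u - φ q.1) / a)) hq
      (min_le_left _ _))
    rw [hfφ] at h
    have h2 := mul_le_mul_of_nonpos_left (min_le_right q.2 ((u - φ q.1) / a)) hneg.le
    rw [mul_div_cancel₀ _ hneg.ne] at h2
    linarith
  rcases ha0.eq_or_lt with ha0 | ha0
  · rw [← ha0, zero_mul, add_zero] at hfx
    -- Vertical hyperplane: `φ` alone separates, and scaling it by `k` makes the gap `|c|`, enough
    -- since the second coordinates are nonpositive.
    set k : ℝ := |c| / (φ x - u) with hk
    have hk0 : 0 ≤ k := div_nonneg (abs_nonneg _) (by linarith)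
    have hkc : k * (φ x - u) = |c| := div_mul_cancel₀ _ (by linarith)
    refine ⟨k • φ, (lintegral_exp_le μ (k • φ) (u := k * u) fun q hq => ?_).trans ?_⟩
    · have h1 := hf q hq
      rw [hfφ, ← ha0, zero_mul, add_zero] at h1
      have h2 := snd_nonpos_of_mem_hypograph hq
      have h3 := mul_le_mul_of_nonneg_left h1.le hk0
      simp only [smul_apply, smul_eq_mul]
      linarith
    · simp only [smul_apply, smul_eq_mul]
      gcongr
      linarith [neg_abs_le c]
  · refine ⟨a⁻¹ • φ, (lintegral_exp_le μ (a⁻¹ • φ) (u := a⁻¹ * u) fun q hq => ?_).trans ?_⟩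
    · have h1 := hf q hq
      rw [hfφ] at h1
      simp only [smul_apply, smul_eq_mul]
      rw [le_inv_mul_iff₀ ha0, mul_add, mul_inv_cancel_left₀ ha0.ne']
      exact h1.le
    · simp only [smul_apply, smul_eq_mul]
      gcongr
      rw [inv_mul_le_iff₀ ha0, mul_add, mul_inv_cancel_left₀ ha0.ne']
      exact hfx.le

/-! ### Transfer to the completion, then exponential Chebyshev. -/

section Isometry

variable {F : Type*} [NormedAddCommGroup F] [NormedSpace ℝ F] [SecondCountableTopology F]
  [MeasurableSpace F] [BorelSpace F]

theorem sumLaw_map (μ : Measure E) [IsProbabilityMeasure μ] (f : E →L[ℝ] F) (n : ℕ) :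
    sumLaw (μ.map f) n = (sumLaw μ n).map f := by
  have hf : Measurable f := f.continuous.measurable
  have := Measure.isProbabilityMeasure_map (μ := μ) hf.aemeasurable
  induction n with
  | zero => simp [sumLaw, Measure.map_dirac' hf]
  | succ n ih => rw [sumLaw, ih, sumLaw, Measure.map_conv_continuousLinearMap]

theorem mem_hypograph_map_iff (μ : Measure E) [IsProbabilityMeasure μ] (f : E →ₗᵢ[ℝ] F) {x : E}
    {t : ℝ} : (f x, t) ∈ hypograph (μ.map f) ↔ (x, t) ∈ hypograph μ := by
  have h (n : ℕ) (r : ℝ) : sumLaw (μ.map f) n (Metric.ball ((n : ℝ) • f x) r) =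
      sumLaw μ n (Metric.ball ((n : ℝ) • x) r) := by
    rw [← f.coe_toContinuousLinearMap, sumLaw_map, Measure.map_apply
      f.toContinuousLinearMap.continuous.measurable Metric.isOpen_ball.measurableSet,
      f.coe_toContinuousLinearMap, ← map_smul, f.isometry.preimage_ball]
  simp only [hypograph, Set.mem_ofPred_eq, h]

end Isometry

/-- An isometric embedding preserves the masses of the balls centred in its range, so the point
stays outside the hypograph in the completion; the functional found there is restricted. -/
theorem exists_lintegral_exp_le (μ : Measure E) [IsProbabilityMeasure μ] {x : E} {c : ℝ}
    (hx : (x, c) ∉ hypograph μ) :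
    ∃ φ : E →L[ℝ] ℝ, ∫⁻ y, ENNReal.ofReal (Real.exp (φ y)) ∂μ ≤
      ENNReal.ofReal (Real.exp (φ x + c)) := by
  borelize (UniformSpace.Completion E)
  have := UniformSpace.secondCountable_of_separable (UniformSpace.Completion E)
  let i : E →ₗᵢ[ℝ] UniformSpace.Completion E := UniformSpace.Completion.toComplₗᵢ
  have hi : Measurable i := i.continuous.measurable
  have := Measure.isProbabilityMeasure_map (μ := μ) hi.aemeasurable
  obtain ⟨φ, hφ⟩ := exists_lintegral_exp_le_of_completeSpace (μ.map i) (x := i x) (c := c)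
    (by rwa [mem_hypograph_map_iff])
  refine ⟨φ.comp i.toContinuousLinearMap, ?_⟩
  rwa [lintegral_map (by fun_prop) hi] at hφ

/-- The exponential Chebyshev inequality. -/
theorem exp_le_lintegral_exp (μ : Measure E) [IsProbabilityMeasure μ] {x : E} {t : ℝ}
    (hx : (x, t) ∈ hypograph μ) (φ : E →L[ℝ] ℝ) :
    ENNReal.ofReal (Real.exp (φ x + t)) ≤ ∫⁻ y, ENNReal.ofReal (Real.exp (φ y)) ∂μ := by
  have key (ε : ℝ) (hε : 0 < ε) : ENNReal.ofReal (Real.exp (φ x + t - (‖φ‖ + 1) * ε)) ≤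
      ∫⁻ y, ENNReal.ofReal (Real.exp (φ y)) ∂μ := by
    obtain ⟨n, hn, hn0⟩ := ((hx ε hε).and (eventually_ne_atTop 0)).exists
    rw [← ENNReal.pow_le_pow_left_iff hn0, ← lintegral_exp_sumLaw]
    refine le_trans ?_ (setLIntegral_le_lintegral (Metric.ball ((n : ℝ) • x) (n * ε)) _)
    refine le_trans ?_ (setLIntegral_mono' (f := fun _ =>
      ENNReal.ofReal (Real.exp (n * (φ x - ‖φ‖ * ε)))) Metric.isOpen_ball.measurableSet
      fun y hy => ?_)
    · rw [setLIntegral_const]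
      refine le_trans ?_ (mul_le_mul_right hn _)
      rw [← ENNReal.ofReal_mul (Real.exp_pos _).le, ← Real.exp_add,
        ← ENNReal.ofReal_pow (Real.exp_pos _).le, ← Real.exp_nat_mul]
      gcongr ENNReal.ofReal (Real.exp ?_)
      linarith
    · have h1 := φ.le_opNorm (y - (n : ℝ) • x)
      have h2 : ‖φ‖ * ‖y - (n : ℝ) • x‖ ≤ ‖φ‖ * (n * ε) :=
        mul_le_mul_of_nonneg_left (mem_ball_iff_norm.1 hy).le (norm_nonneg _)
      rw [map_sub, map_smul, smul_eq_mul, Real.norm_eq_abs] at h1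
      have h3 := (abs_le.1 (h1.trans h2)).1
      gcongr
      linarith
  have hlim : Tendsto (fun ε : ℝ => ENNReal.ofReal (Real.exp (φ x + t - (‖φ‖ + 1) * ε)))
      (𝓝[>] 0) (𝓝 (ENNReal.ofReal (Real.exp (φ x + t)))) := by
    have : Continuous fun ε : ℝ => ENNReal.ofReal (Real.exp (φ x + t - (‖φ‖ + 1) * ε)) :=
      ENNReal.continuous_ofReal.comp (by fun_prop)
    simpa using (this.tendsto 0).mono_left nhdsWithin_le_nhds
  exact le_of_tendsto hlim (eventually_mem_nhdsWithin.mono key)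

end LargeDeviations

/-! ### Return to empirical means. -/

namespace LargeDeviations

theorem limsup_logProb_eq {Ω E : Type*} [MeasurableSpace Ω] (P : Measure Ω) (Z : ℕ → Ω → E)
    (A : Set E) : limsup (logProb P Z (fun n => (n : ℝ)) A) atTop =
      ExpGrowth.expGrowthSup fun n => P (Z n ⁻¹' A) := by
  refine limsup_congr (Eventually.of_forall fun n => ?_)
  rw [logProb, EReal.coe_inv, EReal.coe_natCast, mul_comm, EReal.div_eq_inv_mul, mul_comm]

theorem liminf_logProb_eq {Ω E : Type*} [MeasurableSpace Ω] (P : Measure Ω) (Z : ℕ → Ω → E)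
    (A : Set E) : liminf (logProb P Z (fun n => (n : ℝ)) A) atTop =
      ExpGrowth.expGrowthInf fun n => P (Z n ⁻¹' A) := by
  refine liminf_congr (Eventually.of_forall fun n => ?_)
  rw [logProb, EReal.coe_inv, EReal.coe_natCast, mul_comm, EReal.div_eq_inv_mul, mul_comm]

theorem exp_coe_mul_natCast (t : ℝ) (n : ℕ) :
    EReal.exp ((t : EReal) * n) = ENNReal.ofReal (Real.exp (n * t)) := by
  rw [← EReal.coe_natCast, ← EReal.coe_mul, EReal.exp_coe, mul_comm]

section EmpiricalMean

variable {Ω E : Type*} [MeasurableSpace Ω] {P : Measure Ω} [IsProbabilityMeasure P]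
  [NormedAddCommGroup E] [NormedSpace ℝ E] [SecondCountableTopology E]
  [MeasurableSpace E] [BorelSpace E] {X : ℕ → Ω → E}

theorem measure_empiricalMean_ball (hmeas : ∀ k, Measurable (X k)) (hindep : iIndepFun X P)
    (hident : ∀ k, IdentDistrib (X k) (X 0) P P) {n : ℕ} (hn : n ≠ 0) (x : E) (r : ℝ) :
    P (empiricalMean X n ⁻¹' Metric.ball x r) =
      sumLaw (P.map (X 0)) n (Metric.ball ((n : ℝ) • x) (n * r)) := by
  rw [← map_sum_range_eq_sumLaw P X hmeas hindep hident,
    Measure.map_apply (by fun_prop) Metric.isOpen_ball.measurableSet]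
  congr 1
  ext ω
  have hn0 : (0 : ℝ) < n := by positivity
  have h : dist (∑ k ∈ Finset.range n, X k ω) ((n : ℝ) • x) = n * dist (empiricalMean X n ω) x := by
    rw [empiricalMean, ← smul_inv_smul₀ hn0.ne' (∑ k ∈ Finset.range n, X k ω), dist_smul₀,
      Real.norm_natCast, smul_inv_smul₀ hn0.ne']
  rw [Set.mem_preimage, Set.mem_preimage, Metric.mem_ball, Metric.mem_ball, h,
    mul_lt_mul_iff_right₀ hn0]

theorem coe_le_entropy_iff (hmeas : ∀ k, Measurable (X k)) (hindep : iIndepFun X P)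
    (hident : ∀ k, IdentDistrib (X k) (X 0) P P) (x : E) (t : ℝ) :
    (t : EReal) ≤ entropy P (empiricalMean X) (fun n => (n : ℝ)) x ↔
      (x, t) ∈ hypograph (P.map (X 0)) := by
  have hball {n : ℕ} (hn : n ≠ 0) := measure_empiricalMean_ball hmeas hindep hident hn
  simp only [entropy, liminf_logProb_eq, le_iInf_iff, Set.mem_ofPred_eq]
  constructor
  · intro h ε hε
    have h1 := h (Metric.ball x ε) ⟨Metric.ball_mem_nhds x hε, Metric.isOpen_ball.measurableSet⟩
    have h2 : ((t - ε : ℝ) : EReal) < t := by exact_mod_cast sub_lt_self t hε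
    filter_upwards [ExpGrowth.eventually_exp_le (h2.trans_le h1), eventually_ne_atTop 0]
      with n hn hn0
    rwa [hball hn0, exp_coe_mul_natCast] at hn
  · rintro h V ⟨hV, -⟩
    obtain ⟨ε, hε, hεV⟩ := Metric.mem_nhds_iff.1 hV
    refine EReal.ge_of_forall_gt_iff_ge.1 fun s hs => ?_
    have hs' : s < t := by exact_mod_cast hs
    refine Eventually.le_expGrowthInf ?_
    filter_upwards [h (min ε (t - s)) (lt_min hε (sub_pos.2 hs')), eventually_ne_atTop 0]
      with n hn hn0
    rw [exp_coe_mul_natCast]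
    rw [← hball hn0] at hn
    refine le_trans ?_ (hn.trans (measure_mono (Set.preimage_mono
      ((Metric.ball_subset_ball (min_le_left _ _)).trans hεV))))
    gcongr
    linarith [min_le_right ε (t - s)]

theorem pressure_empiricalMean (hmeas : ∀ k, Measurable (X k)) (hindep : iIndepFun X P)
    (hident : ∀ k, IdentDistrib (X k) (X 0) P P) (φ : E →L[ℝ] ℝ) :
    pressure P (empiricalMean X) (fun n => (n : ℝ)) φ =
      ENNReal.log (∫⁻ x, ENNReal.ofReal (Real.exp (φ x)) ∂(P.map (X 0))) := by
  have := Measure.isProbabilityMeasure_map (μ := P) (hmeas 0).aemeasurable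
  rw [← ExpGrowth.expGrowthSup_pow]
  refine limsup_congr ?_
  filter_upwards [eventually_ne_atTop 0] with n hn
  have hn0 : (n : ℝ) ≠ 0 := by positivity
  rw [EReal.coe_inv, EReal.coe_natCast, mul_comm, EReal.div_eq_inv_mul, mul_comm,
    ← lintegral_exp_sumLaw, ← map_sum_range_eq_sumLaw P X hmeas hindep hident,
    lintegral_map (by fun_prop) (by fun_prop)]
  simp only [empiricalMean, map_smul, smul_eq_mul, mul_inv_cancel_left₀ hn0]

theorem coe_le_neg_fenchelLegendre_iff (hmeas : ∀ k, Measurable (X k)) (hindep : iIndepFun X P)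
    (hident : ∀ k, IdentDistrib (X k) (X 0) P P) (x : E) (t : ℝ) :
    (t : EReal) ≤ -fenchelLegendre (pressure P (empiricalMean X) (fun n => (n : ℝ))) x ↔
      ∀ φ : E →L[ℝ] ℝ, ENNReal.ofReal (Real.exp (φ x + t)) ≤
        ∫⁻ x, ENNReal.ofReal (Real.exp (φ x)) ∂(P.map (X 0)) := by
  rw [EReal.le_neg, fenchelLegendre, iSup_le_iff]
  refine forall_congr' fun φ => ?_
  rw [pressure_empiricalMean hmeas hindep hident, ← ENNReal.log_le_log_iff,
    ENNReal.log_ofReal_of_pos (Real.exp_pos _), Real.log_exp]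
  generalize ENNReal.log _ = p
  induction p with
  | bot => simp
  | top => simp
  | coe p =>
    norm_cast
    constructor <;> intro h <;> linarith

theorem entropy_eq_neg_fenchelLegendre (hmeas : ∀ k, Measurable (X k)) (hindep : iIndepFun X P)
    (hident : ∀ k, IdentDistrib (X k) (X 0) P P) (x : E) :
    entropy P (empiricalMean X) (fun n => (n : ℝ)) x =
      -fenchelLegendre (pressure P (empiricalMean X) (fun n => (n : ℝ))) x := by
  have := Measure.isProbabilityMeasure_map (μ := P) (hmeas 0).aemeasurable
  refine le_antisymm ?_ ?_
  · refine EReal.ge_of_forall_gt_iff_ge.1 fun t ht => ?_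
    rw [coe_le_neg_fenchelLegendre_iff hmeas hindep hident]
    exact exp_le_lintegral_exp _ ((coe_le_entropy_iff hmeas hindep hident x t).1 ht.le)
  · by_contra! hlt
    -- Two reals are needed because the separating bound at `c` is not strict.
    obtain ⟨c, hc, hc'⟩ := EReal.lt_iff_exists_real_btwn.1 hlt
    obtain ⟨d, hd, hd'⟩ := EReal.lt_iff_exists_real_btwn.1 hc'
    rw [← not_le, coe_le_entropy_iff hmeas hindep hident] at hc
    obtain ⟨φ, hφ⟩ := exists_lintegral_exp_le _ hc
    have h := ((coe_le_neg_fenchelLegendre_iff hmeas hindep hident x d).1 hd'.le φ).trans hφ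
    rw [ENNReal.ofReal_le_ofReal_iff (Real.exp_pos _).le, Real.exp_le_exp] at h
    have : c < d := by exact_mod_cast hd
    linarith

theorem weakLDP_empiricalMean (hmeas : ∀ k, Measurable (X k)) (hindep : iIndepFun X P)
    (hident : ∀ k, IdentDistrib (X k) (X 0) P P) :
    WeakLDP P (empiricalMean X) (fun n => (n : ℝ))
      (entropy P (empiricalMean X) (fun n => (n : ℝ))) := by
  have := Measure.isProbabilityMeasure_map (μ := P) (hmeas 0).aemeasurable
  -- For the lower bound, `G` is itself a measurable neighborhood of each of its interior points.
  refine ⟨fun G hG => iSup₂_le fun x hx => iInf₂_le G ⟨mem_interior_iff_mem_nhds.1 hx, hG⟩,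
    fun K _ hK => EReal.le_of_forall_lt_iff_le.1 fun c hc => ?_⟩
  have hex (x : E) (hx : x ∈ closure K) : ∃ ε > 0, ∀ n : ℕ,
      sumLaw (P.map (X 0)) n (Metric.ball ((n : ℝ) • x) (n * ε)) ≤
        ENNReal.ofReal (Real.exp (n * c)) := by
    refine exists_sumLaw_ball_le ?_
    rw [← coe_le_entropy_iff hmeas hindep hident, not_le]
    exact (le_iSup₂ (f := fun x _ => entropy P (empiricalMean X) (fun n => (n : ℝ)) x) x hx).trans_lt
      hc
  choose! ε hε h using hex
  obtain ⟨t, htK, ht⟩ := hK.elim_nhds_subcover (fun x => Metric.ball x (ε x))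
    fun x hx => Metric.ball_mem_nhds x (hε x hx)
  rw [limsup_logProb_eq]
  refine (ExpGrowth.expGrowthSup_monotone (b := ∑ x ∈ t, fun n =>
    P (empiricalMean X n ⁻¹' Metric.ball x (ε x))) fun n => ?_).trans ?_
  · rw [Finset.sum_apply]
    refine le_trans (measure_mono ?_) (measure_biUnion_finset_le t _)
    rw [← Set.preimage_iUnion₂]
    exact Set.preimage_mono (subset_closure.trans ht)
  · rw [ExpGrowth.expGrowthSup_sum]
    refine iSup₂_le fun x hx => Eventually.expGrowthSup_le ?_
    filter_upwards [eventually_ne_atTop 0] with n hn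
    rw [measure_empiricalMean_ball hmeas hindep hident hn, exp_coe_mul_natCast]
    exact h x (htK x hx) n

end EmpiricalMean

end LargeDeviations

theorem mainTheorem6 {Ω E : Type*} [MeasurableSpace Ω] (P : Measure Ω) [IsProbabilityMeasure P]
    [NormedAddCommGroup E] [NormedSpace ℝ E] [TopologicalSpace.SeparableSpace E]
    [MeasurableSpace E] [BorelSpace E]
    (X : ℕ → Ω → E) (hmeas : ∀ k, Measurable (X k)) (hindep : iIndepFun X P)
    (hident : ∀ k, IdentDistrib (X k) (X 0) P P) :
    LargeDeviations.WeakLDP P (LargeDeviations.empiricalMean X) (fun n => (n : ℝ))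
        (LargeDeviations.entropy P (LargeDeviations.empiricalMean X) (fun n => (n : ℝ))) ∧
      (∀ x : E,
        LargeDeviations.entropy P (LargeDeviations.empiricalMean X) (fun n => (n : ℝ)) x =
          -LargeDeviations.fenchelLegendre
            (LargeDeviations.pressure P (LargeDeviations.empiricalMean X) (fun n => (n : ℝ))) x) ∧
      (∀ φ : E →L[ℝ] ℝ,
        LargeDeviations.pressure P (LargeDeviations.empiricalMean X) (fun n => (n : ℝ)) φ =
          ENNReal.log (∫⁻ ω, ENNReal.ofReal (Real.exp (φ (X 0 ω))) ∂P)) := by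
  have := UniformSpace.secondCountable_of_separable E
  refine ⟨LargeDeviations.weakLDP_empiricalMean hmeas hindep hident,
    LargeDeviations.entropy_eq_neg_fenchelLegendre hmeas hindep hident, fun φ => ?_⟩
  rw [LargeDeviations.pressure_empiricalMean hmeas hindep hident,
    lintegral_map (by fun_prop) (hmeas 0)]
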